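/- Let $\mathbb D$ be the open unit disk in $\mathbb C$. A weight is a bounded, continuous, strictly positive function $\mu:\mathbb D\to(0,\infty)$. The $\mu$-Bloch space $\mathcal B^\mu$ consists of all holomorphic $f:\mathbb D\to\mathbb C$ with $\|f\|_\mu:=\sup_{z\in\mathbb D}\mu(z)|f'(z)|<\infty$, with norm $\|f\|_{\mathcal B^\mu}:=|f(0)|+\|f\|_\mu$. For the weight $v_{\log}(z)=(1-|z|)\log\frac{3}{1-|z|}$ write $\mathcal B^{\log}:=\mathcal B^{v_{\log}}$ and $\|\cdot\|_{\log}:=\|\cdot\|_{v_{\log}}$. For a bounded linear operator $T:X\to Y$ between normed spaces, the essential norm is $\|T\|_e:=\inf\{\|T-K\| : K:X\to Y \text{ compact linear}\}$. Theorem. Let $\mu$ be a weight on $\mathbb D$ and let $\phi:\mathbb D\to\mathbb D$ be holomorphic such that the composition operator $C_\phi f=f\circ\phi$ is a bounded operator from $\mathcal B^{\log}$ to $\mathcal B^\mu$. Put $L=1-\frac{1}{\log 3}$ and $$E:=\limsup_{j\to\infty}\frac{\|\phi^j\|_\mu}{\|z^j\|_{\log}},$$ where $\phi^j$ is the $j$-th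 (pointwise) power of $\phi$ and $z^j$ denotes the function $z\mapsto z^j$. Then $E$ is finite and $$E\;\le\;\|C_\phi\|_e\;\le\;\frac{2L+6e^{L-1}}{L}\,E .$$ In particular $\|C_\phi\|_e$ and $E$ are comparable with constants that depend neither on $\phi$ nor on $\mu$. -/

import Mathlib

open Filter
open scoped Complex.UnitDisc

/-- A function on the open unit disc, extended by `0` to the complex plane. -/
noncomputable def discExt (f : 𝔻 → ℂ) (w : ℂ) : ℂ :=
  if h : ‖w‖ < 1 then f (Complex.UnitDisc.mk w h) else 0

/-- `f` is holomorphic on the open unit disc. -/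
def DiscHolomorphic (f : 𝔻 → ℂ) : Prop :=
  DifferentiableOn ℂ (discExt f) (Metric.ball 0 1)

/-- The complex derivative of a function on the open unit disc. The disc is open, so the extension
by `0` plays no role. -/
noncomputable def discDeriv (f : 𝔻 → ℂ) (z : 𝔻) : ℂ :=
  deriv (discExt f) (z : ℂ)

/-- A weight: a bounded, continuous and strictly positive function on the unit disc. -/
structure DiscWeight where
  /-- The underlying function. -/
  toFun : 𝔻 → ℝ
  continuous' : Continuous toFun
  pos' : ∀ z, 0 < toFun z
  bounded' : ∃ C, ∀ z, toFun z ≤ C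

instance : CoeFun DiscWeight (fun _ => 𝔻 → ℝ) := ⟨DiscWeight.toFun⟩

/-- The semi-norm `‖f‖_μ = sup_z μ(z) |f'(z)|` (used only for functions for which the supremum
is finite). -/
noncomputable def blochSeminorm (μ : DiscWeight) (f : 𝔻 → ℂ) : ℝ :=
  ⨆ z : 𝔻, μ z * ‖discDeriv f z‖

/-- Membership in the `μ`-Bloch space: `f` is holomorphic and `sup_z μ(z) |f'(z)| < ∞`. -/
def IsBloch (μ : DiscWeight) (f : 𝔻 → ℂ) : Prop :=
  DiscHolomorphic f ∧ BddAbove (Set.range fun z : 𝔻 => μ z * ‖discDeriv f z‖)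

theorem DiscHolomorphic.differentiableAt {f : 𝔻 → ℂ} (hf : DiscHolomorphic f) (z : 𝔻) :
    DifferentiableAt ℂ (discExt f) (z : ℂ) :=
  DifferentiableOn.differentiableAt hf
    (Metric.isOpen_ball.mem_nhds (mem_ball_zero_iff.2 z.norm_lt_one))

theorem discExt_coe (f : 𝔻 → ℂ) (z : 𝔻) : discExt f (z : ℂ) = f z := by
  simp [discExt, z.norm_lt_one]

theorem discExt_add (f g : 𝔻 → ℂ) : discExt (f + g) = discExt f + discExt g := by
  funext w
  by_cases h : ‖w‖ < 1 <;> simp [discExt, h]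

theorem discExt_smul (c : ℂ) (f : 𝔻 → ℂ) : discExt (c • f) = c • discExt f := by
  funext w
  by_cases h : ‖w‖ < 1 <;> simp [discExt, h]

theorem discExt_zero : discExt 0 = 0 := by
  funext w
  by_cases h : ‖w‖ < 1 <;> simp [discExt, h]

theorem discDeriv_add {f g : 𝔻 → ℂ} (hf : DiscHolomorphic f) (hg : DiscHolomorphic g) (z : 𝔻) :
    discDeriv (f + g) z = discDeriv f z + discDeriv g z := by
  rw [discDeriv, discExt_add]
  exact deriv_add (hf.differentiableAt z) (hg.differentiableAt z)

theorem discDeriv_smul (c : ℂ) (f : 𝔻 → ℂ) (z : 𝔻) :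
    discDeriv (c • f) z = c * discDeriv f z := by
  rw [discDeriv, discExt_smul, deriv_const_smul_field, smul_eq_mul, discDeriv]

/-- The `μ`-Bloch space as a linear subspace of the functions on the disc. -/
def blochSubmodule (μ : DiscWeight) : Submodule ℂ (𝔻 → ℂ) where
  carrier := {f | IsBloch μ f}
  zero_mem' := by
    refine ⟨?_, 0, ?_⟩
    · rw [DiscHolomorphic, discExt_zero]
      exact differentiableOn_const 0
    · rintro _ ⟨z, rfl⟩
      simp [discDeriv, discExt_zero]
  add_mem' := by
    rintro f g ⟨hf, A, hA⟩ ⟨hg, B, hB⟩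
    refine ⟨?_, A + B, ?_⟩
    · rw [DiscHolomorphic, discExt_add]
      exact DifferentiableOn.add hf hg
    · rintro _ ⟨z, rfl⟩
      have h1 := hA ⟨z, rfl⟩
      have h2 := hB ⟨z, rfl⟩
      have h3 := mul_le_mul_of_nonneg_left (norm_add_le (discDeriv f z) (discDeriv g z))
        (μ.pos' z).le
      simp only [discDeriv_add hf hg] at *
      linarith
  smul_mem' := by
    rintro c f ⟨hf, A, hA⟩
    refine ⟨?_, ‖c‖ * A, ?_⟩
    · rw [DiscHolomorphic, discExt_smul]
      exact DifferentiableOn.const_smul hf c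
    · rintro _ ⟨z, rfl⟩
      have h1 := mul_le_mul_of_nonneg_left (hA ⟨z, rfl⟩) (norm_nonneg c)
      simp only [discDeriv_smul, norm_mul] at *
      linarith

/-- The `μ`-Bloch space `𝓑^μ` of the unit disc, as a type of its own: its topology is the one of
the norm below, not the topology of pointwise convergence. -/
def BlochSpace (μ : DiscWeight) : Type := ↥(blochSubmodule μ)

namespace BlochSpace

variable {μ : DiscWeight}

noncomputable instance : AddCommGroup (BlochSpace μ) :=
  inferInstanceAs (AddCommGroup ↥(blochSubmodule μ))

noncomputable instance : Module ℂ (BlochSpace μ) :=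
  inferInstanceAs (Module ℂ ↥(blochSubmodule μ))

/-- The function underlying an element of the `μ`-Bloch space. -/
def toFun (f : BlochSpace μ) : 𝔻 → ℂ := f.1

theorem isBloch (f : BlochSpace μ) : IsBloch μ f.toFun := f.2

/-- A function with the Bloch property, as an element of the `μ`-Bloch space. -/
def mk (f : 𝔻 → ℂ) (hf : IsBloch μ f) : BlochSpace μ := ⟨f, hf⟩

/-- The norm `‖f‖_{𝓑^μ} = |f(0)| + ‖f‖_μ`. -/
noncomputable instance : Norm (BlochSpace μ) :=
  ⟨fun f => ‖f.toFun 0‖ + blochSeminorm μ f.toFun⟩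

theorem norm_def (f : BlochSpace μ) : ‖f‖ = ‖f.toFun 0‖ + blochSeminorm μ f.toFun := rfl

theorem le_seminorm (f : BlochSpace μ) (z : 𝔻) :
    μ z * ‖discDeriv f.toFun z‖ ≤ blochSeminorm μ f.toFun :=
  le_ciSup f.isBloch.2 z

theorem seminorm_nonneg (f : 𝔻 → ℂ) : 0 ≤ blochSeminorm μ f :=
  Real.iSup_nonneg fun z => mul_nonneg (μ.pos' z).le (norm_nonneg _)

theorem core (μ : DiscWeight) : NormedSpace.Core ℂ (BlochSpace μ) where
  norm_nonneg f := add_nonneg (norm_nonneg _) (seminorm_nonneg _)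
  norm_smul c f := by
    have h : ∀ z, discDeriv (c • f).toFun z = c * discDeriv f.toFun z :=
      discDeriv_smul c f.toFun
    have h0 : (c • f).toFun 0 = c * f.toFun 0 := rfl
    rw [norm_def, norm_def, h0, norm_mul, mul_add, blochSeminorm, blochSeminorm,
      Real.mul_iSup_of_nonneg (norm_nonneg c)]
    congr 2
    funext z
    rw [h, norm_mul]
    ring
  norm_triangle f g := by
    have h : ∀ z, discDeriv (f + g).toFun z = discDeriv f.toFun z + discDeriv g.toFun z :=
      discDeriv_add f.isBloch.1 g.isBloch.1
    have h0 : (f + g).toFun 0 = f.toFun 0 + g.toFun 0 := rfl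
    have h1 : blochSeminorm μ (f + g).toFun ≤
        blochSeminorm μ f.toFun + blochSeminorm μ g.toFun := by
      refine ciSup_le fun z => ?_
      have h2 := mul_le_mul_of_nonneg_left
        (norm_add_le (discDeriv f.toFun z) (discDeriv g.toFun z)) (μ.pos' z).le
      have h3 := f.le_seminorm z
      have h4 := g.le_seminorm z
      rw [h]
      linarith
    have h5 := norm_add_le (f.toFun 0) (g.toFun 0)
    rw [norm_def, norm_def, norm_def, h0]
    linarith
  norm_eq_zero_iff f := by
    constructor
    · intro h
      have hs := seminorm_nonneg (μ := μ) f.toFun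
      have hn := norm_nonneg (f.toFun 0)
      rw [norm_def] at h
      have hd : ∀ z, discDeriv f.toFun z = 0 := by
        intro z
        have h1 := f.le_seminorm z
        have h2 : ‖discDeriv f.toFun z‖ ≤ 0 := by
          by_contra h3
          have := mul_pos (μ.pos' z) (not_le.1 h3)
          linarith
        exact norm_le_zero_iff.1 h2
      have h0 : f.toFun 0 = 0 := norm_le_zero_iff.1 (by linarith)
      have hE : Set.EqOn (deriv (discExt f.toFun)) 0 (Metric.ball 0 1) := by
        intro w hw
        exact hd (Complex.UnitDisc.mk w (mem_ball_zero_iff.1 hw))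
      apply Subtype.ext
      funext z
      have h1 := Metric.isOpen_ball.is_const_of_deriv_eq_zero
        (convex_ball (0 : ℂ) 1).isPreconnected f.isBloch.1 hE
        (mem_ball_zero_iff.2 z.norm_lt_one) (mem_ball_zero_iff.2 (0 : 𝔻).norm_lt_one)
      rw [discExt_coe, discExt_coe, h0] at h1
      exact h1
    · rintro rfl
      have h0 : (0 : BlochSpace μ).toFun = 0 := rfl
      rw [norm_def, h0]
      simp [blochSeminorm, discDeriv, discExt_zero]

noncomputable instance : NormedAddCommGroup (BlochSpace μ) := NormedAddCommGroup.ofCore (core μ)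

noncomputable instance : NormedSpace ℂ (BlochSpace μ) := NormedSpace.ofCore (core μ)

end BlochSpace

/-- The logarithmic weight `v_log(z) = (1 - |z|) log (3 / (1 - |z|))`. -/
noncomputable def logWeight : DiscWeight where
  toFun z := (1 - ‖(z : ℂ)‖) * Real.log (3 / (1 - ‖(z : ℂ)‖))
  continuous' := by
    have h : Continuous fun z : 𝔻 => 1 - ‖(z : ℂ)‖ :=
      continuous_const.sub Complex.UnitDisc.continuous_coe.norm
    have hp : ∀ z : 𝔻, 1 - ‖(z : ℂ)‖ ≠ 0 := fun z => (sub_pos.2 z.norm_lt_one).ne'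
    exact h.mul ((continuous_const.div h hp).log fun z => div_ne_zero (by norm_num) (hp z))
  pos' z := by
    have h := sub_pos.2 z.norm_lt_one
    refine mul_pos h (Real.log_pos ?_)
    rw [lt_div_iff₀ h]
    linarith [norm_nonneg (z : ℂ)]
  bounded' := by
    refine ⟨3, fun z => ?_⟩
    have h := sub_pos.2 z.norm_lt_one
    calc (1 - ‖(z : ℂ)‖) * Real.log (3 / (1 - ‖(z : ℂ)‖))
        ≤ (1 - ‖(z : ℂ)‖) * (3 / (1 - ‖(z : ℂ)‖)) :=
          mul_le_mul_of_nonneg_left (Real.log_le_self (by positivity)) h.le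
      _ = 3 := by field_simp

/-- The composition operator `C_φ f = f ∘ φ`, as a linear map `𝓑^ν → 𝓑^μ`, for a self-map `φ` of
the disc that maps `𝓑^ν` into `𝓑^μ`. -/
noncomputable def compOperator {ν μ : DiscWeight} (φ : 𝔻 → 𝔻)
    (h : ∀ f : 𝔻 → ℂ, IsBloch ν f → IsBloch μ (f ∘ φ)) : BlochSpace ν →ₗ[ℂ] BlochSpace μ where
  toFun f := BlochSpace.mk (f.toFun ∘ φ) (h f.toFun f.isBloch)
  map_add' _ _ := rfl
  map_smul' _ _ := rfl

/-- The essential norm of a bounded operator: its distance, in the operator norm, from the set of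
compact operators. -/
noncomputable def essentialNorm {X Y : Type*} [NormedAddCommGroup X] [NormedSpace ℂ X]
    [NormedAddCommGroup Y] [NormedSpace ℂ Y] (T : X →L[ℂ] Y) : ℝ :=
  sInf {r : ℝ | ∃ K : X →L[ℂ] Y, IsCompactOperator K ∧ r = ‖T - K‖}

/-- The quotient `‖φ^j‖_μ / ‖z^j‖_log`. -/
noncomputable def powerRatio (μ : DiscWeight) (φ : 𝔻 → 𝔻) (j : ℕ) : ℝ :=
  blochSeminorm μ (fun z => (φ z : ℂ) ^ j) / blochSeminorm logWeight (fun z => (z : ℂ) ^ j)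

/-- The constant `L = 1 - 1 / log 3`. -/
noncomputable def logConst : ℝ := 1 - 1 / Real.log 3

/-! Lower bound: the normalized monomials `unitMonomial n` have norm one, and every compact `K`
sends them to zero in norm (`IsCompactOperator.tendsto_unitMonomial`). Hence `‖T - K‖` is
asymptotically at least the norms of their images under `T`, which dominate the power ratios. No
weak convergence is invoked: the monomials concentrate near the boundary, so sparse sums of
arbitrarily many of them have norm close to one, while a nonzero cluster point of the images would
make the images of these sums grow linearly.

Upper bound: subtract `T ∘ K`, where `K` is the finite rank operator `taylorDilate`. The derivative
of `f - K f` is uniformly small on a fixed smaller disc and, up to a small error, at most `2 ‖f‖ /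
logWeight` elsewhere (`exists_taylorDilate_close`). Testing a power of `φ` whose degree is about `1
/ (1 - |φ(z)|)` gives `μ |φ'| ≤ 2 e E · logWeight (φ z)` when `φ z` is near the boundary
(`exists_symbol_le`), where `E` is any eventual bound of the ratios. Together these give the
constant `4 e`, which is smaller than the stated one (`four_mul_exp_one_le`). -/

/-! ### Elementary estimates for the logarithmic profile -/

/-- The profile `t ↦ t log (3 / t)` of the logarithmic weight. -/
noncomputable def logProfile (t : ℝ) : ℝ := t * Real.log (3 / t)

theorem logWeight_apply (z : 𝔻) : logWeight z = logProfile (1 - ‖(z : ℂ)‖) := rfl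

theorem one_lt_log_three : 1 < Real.log 3 :=
  lt_trans (by norm_num) Real.log_three_gt_d9

theorem one_le_log_three_div {t : ℝ} (h0 : 0 < t) (h1 : t ≤ 1) : 1 ≤ Real.log (3 / t) := by
  refine one_lt_log_three.le.trans (Real.log_le_log (by norm_num) ?_)
  rw [le_div_iff₀ h0]
  linarith

/-- Passing from `s` to `t` costs `s log (t / s) ≤ t - s`, which is absorbed by `(t - s) log (3 /
t)` because `log (3 / t) ≥ 1`; this is where the 3 in the weight matters. -/
theorem logProfile_mono {s t : ℝ} (hs : 0 < s) (hst : s ≤ t) (ht : t ≤ 1) :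
    logProfile s ≤ logProfile t := by
  have h0 : 0 < t := hs.trans_le hst
  have h1 := one_le_log_three_div h0 ht
  have h2 : Real.log (3 / s) = Real.log (3 / t) + Real.log (t / s) := by
    rw [← Real.log_mul (by positivity) (by positivity)]
    congr 1
    field_simp
  have h3 : s * Real.log (t / s) ≤ t - s := by
    have := mul_le_mul_of_nonneg_left (Real.log_le_sub_one_of_pos (div_pos h0 hs)) hs.le
    rwa [mul_sub, mul_div_cancel₀ _ hs.ne', mul_one] at this
  unfold logProfile
  rw [h2]
  nlinarith

theorem exists_logProfile_le {ε : ℝ} (hε : 0 < ε) :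
    ∃ δ > 0, ∀ t, 0 < t → t < δ → logProfile t ≤ ε := by
  have hc : Continuous fun t : ℝ => t * Real.log 3 + Real.negMulLog t :=
    (continuous_id.mul continuous_const).add Real.continuous_negMulLog
  have h := (hc.tendsto 0).eventually_lt_const (u := ε) (by simpa using hε)
  obtain ⟨δ, hδ, h⟩ := Metric.eventually_nhds_iff.1 h
  refine ⟨δ, hδ, fun t h0 ht => ?_⟩
  have h1 := h (y := t) (by simpa [abs_of_pos h0] using ht)
  have h2 : logProfile t = t * Real.log 3 + Real.negMulLog t := by
    rw [logProfile, Real.log_div (by norm_num) h0.ne', Real.negMulLog]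
    ring
  linarith

/-- A single term of the binomial expansion of `(t + (1 - t)) ^ (n + 1)`. -/
theorem succ_mul_one_sub_pow_le_one {t : ℝ} (h0 : 0 ≤ t) (h1 : t ≤ 1) (n : ℕ) :
    (n + 1) * t * (1 - t) ^ n ≤ 1 := by
  have h := add_pow t (1 - t) (n + 1)
  have h2 := Finset.single_le_sum (s := Finset.range (n + 1 + 1)) (a := 1)
    (f := fun m => t ^ m * (1 - t) ^ (n + 1 - m) * ((n + 1).choose m : ℝ))
    (fun i _ => mul_nonneg (mul_nonneg (pow_nonneg h0 _) (pow_nonneg (by linarith) _))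
      (Nat.cast_nonneg _)) (by simp)
  rw [← h] at h2
  simp at h2
  linarith

/-- With `x = (n + 1) t`, `p = (1 - t) ^ n` and `Λ = log (3 (n + 1))`, the inequality `x log (1 / x)
≤ 1 - x` bounds the left side by `x p (Λ - 1) + p`, and `x p ≤ 1`, `p ≤ 1`, `Λ ≥ 1` finish. -/
theorem logProfile_mul_le {t : ℝ} (h0 : 0 < t) (h1 : t ≤ 1) (n : ℕ) :
    logProfile t * ((n + 1) * (1 - t) ^ n) ≤ Real.log (3 * (n + 1)) := by
  have hn : (0 : ℝ) < n + 1 := by positivity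
  have h2 : Real.log (3 / t) = Real.log (3 * (n + 1)) + Real.log (1 / ((n + 1) * t)) := by
    rw [← Real.log_mul (by positivity) (by positivity)]
    congr 1
    field_simp
  have h3 : (n + 1) * t * Real.log (1 / ((n + 1) * t)) ≤ 1 - (n + 1) * t := by
    have hp : 0 < (n + 1) * t := by positivity
    have := mul_le_mul_of_nonneg_left (Real.log_le_sub_one_of_pos (one_div_pos.2 hp)) hp.le
    rwa [mul_sub, mul_one_div_cancel hp.ne', mul_one] at this
  have h4 := succ_mul_one_sub_pow_le_one h0.le h1 n
  have h5 : (0 : ℝ) ≤ (1 - t) ^ n := pow_nonneg (by linarith) _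
  have h6 : (1 - t) ^ n ≤ 1 := pow_le_one₀ (by linarith) (by linarith)
  have h7 : 1 ≤ Real.log (3 * (n + 1)) := by
    refine one_lt_log_three.le.trans (Real.log_le_log (by norm_num) ?_)
    have : (0 : ℝ) ≤ n := Nat.cast_nonneg n
    linarith
  unfold logProfile
  rw [h2]
  nlinarith [mul_le_mul_of_nonneg_right h3 h5]

theorem exp_neg_one_le_one_sub_pow {t : ℝ} (h1 : t < 1) {n : ℕ}
    (h : (n + 1) * t ≤ 1) : Real.exp (-1) ≤ (1 - t) ^ n := by
  have hp : 0 < 1 - t := by linarith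
  have h2 : (1 - t)⁻¹ ≤ Real.exp (t / (1 - t)) := by
    have := Real.add_one_le_exp (t / (1 - t))
    convert this using 1
    field_simp
    ring
  have h3 : ((1 - t)⁻¹) ^ n ≤ Real.exp 1 := by
    refine (pow_le_pow_left₀ (by positivity) h2 n).trans ?_
    rw [← Real.exp_nat_mul, Real.exp_le_exp, ← mul_div_assoc, div_le_one hp]
    linarith
  rw [Real.exp_neg, inv_le_comm₀ (Real.exp_pos 1) (by positivity), ← inv_pow]
  exact h3

/-! ### Derivatives on the disc -/

theorem discExt_eventuallyEq_of_forall {f : 𝔻 → ℂ} {F : ℂ → ℂ} (h : ∀ z : 𝔻, f z = F z) (z : 𝔻) :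
    discExt f =ᶠ[nhds (z : ℂ)] F := by
  filter_upwards [Metric.isOpen_ball.mem_nhds (mem_ball_zero_iff.2 z.norm_lt_one)] with w hw
  have hw' := mem_ball_zero_iff.1 hw
  simp [discExt, hw', h]

theorem discHolomorphic_of_hasDerivAt {f : 𝔻 → ℂ} {F : ℂ → ℂ} {f' : 𝔻 → ℂ}
    (h : ∀ z : 𝔻, f z = F z) (hF : ∀ z : 𝔻, HasDerivAt F (f' z) z) :
    DiscHolomorphic f ∧ ∀ z, discDeriv f z = f' z := by
  have key : ∀ z : 𝔻, HasDerivAt (discExt f) (f' z) z := fun z =>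
    (hF z).congr_of_eventuallyEq (discExt_eventuallyEq_of_forall h z)
  refine ⟨fun w hw => ?_, fun z => (key z).deriv⟩
  exact (key (Complex.UnitDisc.mk w (mem_ball_zero_iff.1 hw))).differentiableAt.differentiableWithinAt

theorem discHolomorphic_comp {f : 𝔻 → ℂ} {φ : 𝔻 → 𝔻} (hf : DiscHolomorphic f)
    (hφ : DiscHolomorphic fun z => (φ z : ℂ)) :
    DiscHolomorphic (f ∘ φ) ∧
      ∀ z, discDeriv (f ∘ φ) z = discDeriv f (φ z) * discDeriv (fun z => (φ z : ℂ)) z := by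
  refine discHolomorphic_of_hasDerivAt (F := discExt f ∘ discExt fun z => (φ z : ℂ))
    (fun z => ?_) (fun z => ?_)
  · simp [discExt_coe]
  · have h1 := (hφ.differentiableAt z).hasDerivAt
    refine HasDerivAt.comp (z : ℂ) ?_ h1
    rw [discExt_coe]
    exact (hf.differentiableAt (φ z)).hasDerivAt

theorem discHolomorphic_pow (j : ℕ) : DiscHolomorphic (fun z : 𝔻 => (z : ℂ) ^ j) ∧
    ∀ z : 𝔻, discDeriv (fun z : 𝔻 => (z : ℂ) ^ j) z = j * (z : ℂ) ^ (j - 1) :=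
  discHolomorphic_of_hasDerivAt (F := fun w => w ^ j) (fun _ => rfl) fun z => hasDerivAt_pow j (z : ℂ)

/-! ### Monomials in the logarithmic Bloch space -/

theorem logWeight_mul_discDeriv_pow (n : ℕ) (z : 𝔻) :
    logWeight z * ‖discDeriv (fun z : 𝔻 => (z : ℂ) ^ (n + 1)) z‖ =
      logProfile (1 - ‖(z : ℂ)‖) * ((n + 1) * (1 - (1 - ‖(z : ℂ)‖)) ^ n) := by
  rw [(discHolomorphic_pow _).2, logWeight_apply, norm_mul, norm_pow, Nat.add_sub_cancel,
    Complex.norm_natCast]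
  push_cast
  ring

theorem logWeight_mul_discDeriv_pow_le (n : ℕ) (z : 𝔻) :
    logWeight z * ‖discDeriv (fun z : 𝔻 => (z : ℂ) ^ (n + 1)) z‖ ≤ Real.log (3 * (n + 1)) := by
  rw [logWeight_mul_discDeriv_pow]
  exact logProfile_mul_le (sub_pos.2 z.norm_lt_one) (by linarith [norm_nonneg (z : ℂ)]) n

theorem isBloch_pow (n : ℕ) : IsBloch logWeight (fun z : 𝔻 => (z : ℂ) ^ (n + 1)) :=
  ⟨(discHolomorphic_pow _).1, _, by rintro _ ⟨z, rfl⟩; exact logWeight_mul_discDeriv_pow_le n z⟩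

theorem blochSeminorm_pow_le (n : ℕ) :
    blochSeminorm logWeight (fun z : 𝔻 => (z : ℂ) ^ (n + 1)) ≤ Real.log (3 * (n + 1)) :=
  ciSup_le fun z => logWeight_mul_discDeriv_pow_le n z

/-- A crude bound independent of the degree suffices: it makes normalization possible and keeps the
normalizing factors at most `2 e`. -/
theorem le_blochSeminorm_pow (n : ℕ) :
    Real.exp (-1) / 2 ≤ blochSeminorm logWeight (fun z : 𝔻 => (z : ℂ) ^ (n + 1)) := by
  have hn : (0 : ℝ) ≤ n := Nat.cast_nonneg n
  -- The denominator `n + 2` instead of `n + 1` keeps `t < 1` also for `n = 0`; the price is the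
  -- factor `1 / 2`.
  set t : ℝ := 1 / (n + 2) with ht
  have h0 : 0 < t := by positivity
  have h1 : t < 1 := by rw [ht, div_lt_one (by positivity)]; linarith
  have hmem : ‖((1 - t : ℝ) : ℂ)‖ < 1 := by
    rw [Complex.norm_real, Real.norm_of_nonneg (by linarith)]
    linarith
  have h2 := le_ciSup (isBloch_pow n).2 (Complex.UnitDisc.mk _ hmem)
  refine le_trans ?_ h2
  simp only [logWeight_mul_discDeriv_pow]
  have h3 : ‖((Complex.UnitDisc.mk _ hmem : 𝔻) : ℂ)‖ = 1 - t := by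
    rw [Complex.UnitDisc.coe_mk, Complex.norm_real, Real.norm_of_nonneg (by linarith)]
  rw [h3, sub_sub_cancel]
  have h4 := exp_neg_one_le_one_sub_pow h1 (n := n) (by
    rw [ht, mul_one_div, div_le_one (by positivity)]; linarith)
  have h5 : t ≤ logProfile t := le_mul_of_one_le_right h0.le (one_le_log_three_div h0 h1.le)
  have h6 : 1 / 2 ≤ t * (n + 1) := by
    rw [ht, one_div_mul_eq_div, div_le_div_iff₀ (by norm_num) (by positivity)]
    linarith
  calc Real.exp (-1) / 2 = 1 / 2 * Real.exp (-1) := by ring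
    _ ≤ (t * (n + 1)) * (1 - t) ^ n := mul_le_mul h6 h4 (Real.exp_pos _).le (by positivity)
    _ = t * ((n + 1) * (1 - t) ^ n) := by ring
    _ ≤ _ := mul_le_mul_of_nonneg_right h5
      (mul_nonneg (by positivity) (pow_nonneg (by linarith) _))

theorem blochSeminorm_pow_pos (n : ℕ) :
    0 < blochSeminorm logWeight (fun z : 𝔻 => (z : ℂ) ^ (n + 1)) :=
  lt_of_lt_of_le (by positivity) (le_blochSeminorm_pow n)

/-- The monomial `z ^ (n + 1)` normalized in the logarithmic Bloch space. -/
noncomputable def unitMonomial (n : ℕ) : BlochSpace logWeight :=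
  (((blochSeminorm logWeight fun z : 𝔻 => (z : ℂ) ^ (n + 1))⁻¹ : ℝ) : ℂ) •
    BlochSpace.mk _ (isBloch_pow n)

theorem unitMonomial_zero (n : ℕ) : (unitMonomial n).toFun 0 = 0 := by
  change _ * ((0 : 𝔻) : ℂ) ^ (n + 1) = 0
  simp

theorem norm_unitMonomial (n : ℕ) : ‖unitMonomial n‖ = 1 := by
  have h := blochSeminorm_pow_pos n
  rw [unitMonomial, norm_smul, BlochSpace.norm_def, Complex.norm_real,
    Real.norm_of_nonneg (inv_nonneg.2 h.le)]
  have h0 : (BlochSpace.mk _ (isBloch_pow n)).toFun 0 = 0 := by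
    change ((0 : 𝔻) : ℂ) ^ (n + 1) = 0
    simp
  rw [h0, norm_zero, zero_add]
  exact inv_mul_cancel₀ h.ne'

theorem norm_discDeriv_unitMonomial_le (n : ℕ) (z : 𝔻) :
    ‖discDeriv (unitMonomial n).toFun z‖ ≤ 2 * Real.exp 1 * ((n + 1) * ‖(z : ℂ)‖ ^ n) := by
  have h := blochSeminorm_pow_pos n
  have h1 : discDeriv (unitMonomial n).toFun z =
      (((blochSeminorm logWeight fun z : 𝔻 => (z : ℂ) ^ (n + 1))⁻¹ : ℝ) : ℂ) *
        discDeriv (fun z : 𝔻 => (z : ℂ) ^ (n + 1)) z := discDeriv_smul _ _ z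
  have h2 : (blochSeminorm logWeight fun z : 𝔻 => (z : ℂ) ^ (n + 1))⁻¹ ≤ 2 * Real.exp 1 := by
    have h3 := inv_anti₀ (by positivity) (le_blochSeminorm_pow n)
    rwa [Real.exp_neg, inv_div, div_inv_eq_mul] at h3
  rw [h1, norm_mul, Complex.norm_real, Real.norm_of_nonneg (inv_nonneg.2 h.le),
    (discHolomorphic_pow _).2, norm_mul, norm_pow, Nat.add_sub_cancel, Complex.norm_natCast]
  push_cast
  exact mul_le_mul_of_nonneg_right h2 (by positivity)

theorem logWeight_le_log_three (z : 𝔻) : logWeight z ≤ Real.log 3 := by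
  have := logProfile_mono (sub_pos.2 z.norm_lt_one) (by linarith [norm_nonneg (z : ℂ)]) le_rfl
  simpa [logWeight_apply, logProfile] using this

theorem tendsto_succ_mul_pow {ρ : ℝ} (h0 : 0 ≤ ρ) (h1 : ρ < 1) :
    Tendsto (fun n : ℕ => (n + 1) * ρ ^ n) atTop (nhds 0) := by
  have := (tendsto_self_mul_const_pow_of_lt_one h0 h1).add
    (tendsto_pow_atTop_nhds_zero_of_lt_one h0 h1)
  simpa [add_mul] using this

/-! ### Compact operators annihilate the normalized monomials asymptotically -/

/-- The normalized monomials of large degree are almost disjoint, in the logarithmic Bloch norm,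
from any function with bounded derivative. -/
theorem eventually_norm_add_unitMonomial_le {S : BlochSpace logWeight} (h0 : S.toFun 0 = 0)
    {M : ℝ} (hM : ∀ z, ‖discDeriv S.toFun z‖ ≤ M) {A δ : ℝ} (hA : ‖S‖ ≤ A) (h1A : 1 ≤ A)
    (hδ : 0 < δ) : ∀ᶠ n in atTop, ‖S + unitMonomial n‖ ≤ A + δ := by
  have hM0 : 0 ≤ M := (norm_nonneg _).trans (hM 0)
  -- In the annulus of width `η` the weight makes the bounded derivative of `S` contribute at most
  -- `δ`; on the remaining disc the derivatives of the monomials tend uniformly to zero. At each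
  -- point at most one summand is large.
  obtain ⟨η, hη, hsmall⟩ := exists_logProfile_le (show 0 < δ / (M + 1) by positivity)
  have hρ1 : max 0 (1 - η) < 1 := max_lt (by norm_num) (by linarith)
  have hlim := (tendsto_succ_mul_pow (le_max_left 0 (1 - η)) hρ1).const_mul
    (Real.log 3 * (2 * Real.exp 1))
  rw [mul_zero] at hlim
  filter_upwards [hlim.eventually_lt_const hδ] with n hn
  have hz : (S + unitMonomial n).toFun 0 = 0 := by
    change S.toFun 0 + (unitMonomial n).toFun 0 = 0
    rw [h0, unitMonomial_zero, add_zero]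
  rw [BlochSpace.norm_def, hz, norm_zero, zero_add]
  refine ciSup_le fun z => ?_
  have hd : discDeriv (S + unitMonomial n).toFun z =
      discDeriv S.toFun z + discDeriv (unitMonomial n).toFun z :=
    discDeriv_add S.isBloch.1 (unitMonomial n).isBloch.1 z
  have hw := (logWeight.pos' z).le
  have hS : logWeight z * ‖discDeriv S.toFun z‖ ≤ A := by
    refine (S.le_seminorm z).trans (le_trans ?_ hA)
    rw [BlochSpace.norm_def]
    linarith [norm_nonneg (S.toFun 0)]
  have hu : logWeight z * ‖discDeriv (unitMonomial n).toFun z‖ ≤ 1 := by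
    refine ((unitMonomial n).le_seminorm z).trans (le_trans ?_ (norm_unitMonomial n).le)
    rw [BlochSpace.norm_def]
    linarith [norm_nonneg ((unitMonomial n).toFun 0)]
  have htri := mul_le_mul_of_nonneg_left
    (norm_add_le (discDeriv S.toFun z) (discDeriv (unitMonomial n).toFun z)) hw
  rw [hd]
  rcases lt_or_ge (1 - ‖(z : ℂ)‖) η with hlt | hge
  · have h1 := hsmall _ (sub_pos.2 z.norm_lt_one) hlt
    rw [← logWeight_apply] at h1
    have h2 : logWeight z * ‖discDeriv S.toFun z‖ ≤ δ := by
      calc _ ≤ δ / (M + 1) * (M + 1) :=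
            mul_le_mul h1 ((hM z).trans (by linarith)) (norm_nonneg _) (by positivity)
        _ = δ := by field_simp
    linarith
  · have h1 : logWeight z * ‖discDeriv (unitMonomial n).toFun z‖ ≤ δ := by
      have h2 : ‖(z : ℂ)‖ ^ n ≤ max 0 (1 - η) ^ n :=
        pow_le_pow_left₀ (norm_nonneg _) (le_max_of_le_right (by linarith)) n
      calc _ ≤ Real.log 3 * (2 * Real.exp 1 * ((n + 1) * ‖(z : ℂ)‖ ^ n)) :=
            mul_le_mul (logWeight_le_log_three z) (norm_discDeriv_unitMonomial_le n z)
              (norm_nonneg _) (zero_le_one.trans one_lt_log_three.le)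
        _ ≤ Real.log 3 * (2 * Real.exp 1 * ((n + 1) * max 0 (1 - η) ^ n)) := by
            have := one_lt_log_three
            gcongr
        _ ≤ δ := by linarith
    linarith

/-- A gliding hump: sums of `N` normalized monomials whose images under `K` stay close to `y`,
and whose norms grow arbitrarily slowly. -/
theorem exists_sum_unitMonomial {Y : Type*} [NormedAddCommGroup Y] [NormedSpace ℂ Y]
    (K : BlochSpace logWeight →L[ℂ] Y) {y : Y} {ε δ : ℝ} (hδ : 0 < δ)
    (hfreq : ∃ᶠ n in atTop, ‖K (unitMonomial n) - y‖ ≤ ε) (N : ℕ) :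
    ∃ S : BlochSpace logWeight, S.toFun 0 = 0 ∧ (∃ M, ∀ z, ‖discDeriv S.toFun z‖ ≤ M) ∧
      ‖S‖ ≤ 1 + N * δ ∧ ‖K S - N • y‖ ≤ N * ε := by
  induction N with
  | zero =>
    refine ⟨0, rfl, ⟨0, fun z => ?_⟩, by simp, by simp⟩
    have h0 : (0 : BlochSpace logWeight).toFun = 0 := rfl
    simp [h0, discDeriv, discExt_zero]
  | succ N ih =>
    obtain ⟨S, h0, ⟨M, hM⟩, hS, hK⟩ := ih
    obtain ⟨n, hn, hn'⟩ := (hfreq.and_eventually (eventually_norm_add_unitMonomial_le h0 hM hS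
      (by linarith [mul_nonneg (Nat.cast_nonneg (α := ℝ) N) hδ.le]) hδ)).exists
    refine ⟨S + unitMonomial n, ?_, ⟨M + 2 * Real.exp 1 * (n + 1), fun z => ?_⟩, ?_, ?_⟩
    · change S.toFun 0 + (unitMonomial n).toFun 0 = 0
      rw [h0, unitMonomial_zero, add_zero]
    · have hd : discDeriv (S + unitMonomial n).toFun z =
          discDeriv S.toFun z + discDeriv (unitMonomial n).toFun z :=
        discDeriv_add S.isBloch.1 (unitMonomial n).isBloch.1 z
      rw [hd]
      refine (norm_add_le _ _).trans (add_le_add (hM z)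
        ((norm_discDeriv_unitMonomial_le n z).trans ?_))
      refine mul_le_mul_of_nonneg_left (mul_le_of_le_one_right (by positivity) ?_) (by positivity)
      exact pow_le_one₀ (norm_nonneg _) z.norm_lt_one.le
    · push_cast
      linarith
    · have : K (S + unitMonomial n) - (N + 1) • y = (K S - N • y) + (K (unitMonomial n) - y) := by
        rw [map_add, succ_nsmul]
        abel
      rw [this]
      push_cast
      linarith [norm_add_le (K S - N • y) (K (unitMonomial n) - y)]

/-- Otherwise the images have a cluster point `y` with `‖y‖ ≥ ε`. A gliding-hump sum `S` of `N`
monomials then satisfies `‖K S‖ ≥ 3 N ε / 4`, whereas `‖S‖ ≤ 1 + N δ` gives `‖K S‖ ≤ ‖K‖ + N ε / 4`.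
-/
theorem IsCompactOperator.tendsto_unitMonomial {Y : Type*} [NormedAddCommGroup Y]
    [NormedSpace ℂ Y] {K : BlochSpace logWeight →L[ℂ] Y} (hK : IsCompactOperator K) :
    Tendsto (fun n => ‖K (unitMonomial n)‖) atTop (nhds 0) := by
  by_contra hcon
  obtain ⟨ε, hε, hfreq⟩ : ∃ ε > 0, ∃ᶠ n in atTop, ε ≤ ‖K (unitMonomial n)‖ := by
    by_contra! h
    refine hcon (Metric.tendsto_nhds.2 fun ε hε => ?_)
    filter_upwards [h ε hε] with n hn
    simpa using hn
  have hcomp : IsCompact (closure (K '' Metric.closedBall 0 1) ∩ {y : Y | ε ≤ ‖y‖}) :=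
    (IsCompactOperator.isCompact_closure_image_closedBall
      (f := (K : BlochSpace logWeight →ₗ[ℂ] Y)) hK 1).inter_right
      (isClosed_le continuous_const continuous_norm)
  obtain ⟨y, hy, hclus⟩ := hcomp.exists_mapClusterPt_of_frequently
    (f := fun n => K (unitMonomial n)) (l := atTop) (hfreq.mono fun n hn =>
      ⟨subset_closure ⟨_, by simp [norm_unitMonomial], rfl⟩, hn⟩)
  have hyε : ε ≤ ‖y‖ := hy.2
  have hnear : ∃ᶠ n in atTop, ‖K (unitMonomial n) - y‖ ≤ ε / 4 := by
    refine hclus.frequently (p := fun x => ‖x - y‖ ≤ ε / 4) ?_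
    filter_upwards [Metric.ball_mem_nhds y (show 0 < ε / 4 by positivity)] with x hx
    exact (mem_ball_iff_norm.1 hx).le
  have hKn := norm_nonneg K
  set δ := ε / (4 * (‖K‖ + 1)) with hδ
  have hδ0 : 0 < δ := by positivity
  have hKδ : ‖K‖ * δ ≤ ε / 4 := by
    rw [hδ, mul_div_assoc', div_le_div_iff₀ (by positivity) (by norm_num)]
    nlinarith
  -- The two estimates of `‖K S‖` differ by `N ε / 2 - ‖K‖`, so this `N` makes them incompatible.
  obtain ⟨N, hN⟩ := exists_nat_gt (‖K‖ / (ε / 2))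
  rw [div_lt_iff₀ (by positivity)] at hN
  obtain ⟨S, -, -, hS, hKS⟩ := exists_sum_unitMonomial K hδ0 hnear N
  have h1 : N * ‖y‖ ≤ ‖K S‖ + ‖K S - N • y‖ := by
    have : ‖(N • y : Y)‖ = N * ‖y‖ := by rw [← Nat.cast_smul_eq_nsmul ℂ, norm_smul]; simp
    rw [← this]
    have := norm_sub_norm_le (N • y) (K S)
    rw [norm_sub_rev] at this
    linarith
  have h2 : ‖K S‖ ≤ ‖K‖ * (1 + N * δ) :=
    (K.le_opNorm S).trans (mul_le_mul_of_nonneg_left hS hKn)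
  have hN0 : (0 : ℝ) ≤ N := Nat.cast_nonneg N
  nlinarith [mul_le_mul_of_nonneg_left hyε hN0, mul_le_mul_of_nonneg_left hKδ hN0]

/-! ### The lower bound for the essential norm -/

theorem powerRatio_succ_le_norm {μ : DiscWeight} {φ : 𝔻 → 𝔻}
    (hmaps : ∀ f : 𝔻 → ℂ, IsBloch logWeight f → IsBloch μ (f ∘ φ)) (n : ℕ) :
    powerRatio μ φ (n + 1) ≤ ‖compOperator φ hmaps (unitMonomial n)‖ := by
  have h := blochSeminorm_pow_pos n
  rw [unitMonomial, map_smul, norm_smul, Complex.norm_real,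
    Real.norm_of_nonneg (inv_nonneg.2 h.le), powerRatio, div_eq_inv_mul]
  refine mul_le_mul_of_nonneg_left ?_ (inv_nonneg.2 h.le)
  rw [BlochSpace.norm_def]
  exact le_add_of_nonneg_left (norm_nonneg _)

theorem powerRatio_nonneg (μ : DiscWeight) (φ : 𝔻 → 𝔻) (j : ℕ) : 0 ≤ powerRatio μ φ j :=
  div_nonneg (BlochSpace.seminorm_nonneg _) (BlochSpace.seminorm_nonneg _)

theorem isBoundedUnder_powerRatio {μ : DiscWeight} {φ : 𝔻 → 𝔻}
    (hmaps : ∀ f : 𝔻 → ℂ, IsBloch logWeight f → IsBloch μ (f ∘ φ))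
    (hbdd : ∃ C : ℝ, ∀ f : BlochSpace logWeight, ‖compOperator φ hmaps f‖ ≤ C * ‖f‖) :
    IsBoundedUnder (· ≤ ·) atTop (powerRatio μ φ) := by
  obtain ⟨C, hC⟩ := hbdd
  refine isBoundedUnder_of_eventually_le (a := C) ?_
  -- For `j = 0` the monomial is constant with seminorm zero, so it has no normalized version.
  filter_upwards [eventually_ge_atTop 1] with j hj
  obtain ⟨n, rfl⟩ := Nat.exists_eq_add_of_le' hj
  have := hC (unitMonomial n)
  rw [norm_unitMonomial, mul_one] at this
  exact (powerRatio_succ_le_norm hmaps n).trans this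

theorem limsup_powerRatio_le_essentialNorm {μ : DiscWeight} {φ : 𝔻 → 𝔻}
    (hmaps : ∀ f : 𝔻 → ℂ, IsBloch logWeight f → IsBloch μ (f ∘ φ))
    (hbdd : ∃ C : ℝ, ∀ f : BlochSpace logWeight, ‖compOperator φ hmaps f‖ ≤ C * ‖f‖) :
    limsup (powerRatio μ φ) atTop ≤
    essentialNorm ((compOperator φ hmaps).mkContinuousOfExistsBound hbdd) := by
  refine le_csInf ⟨_, 0, isCompactOperator_zero, rfl⟩ ?_
  rintro _ ⟨K, hK, rfl⟩
  set T := (compOperator φ hmaps).mkContinuousOfExistsBound hbdd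
  refine le_of_forall_pos_le_add fun ε hε => ?_
  refine limsup_le_of_le (isCoboundedUnder_le_of_le atTop (powerRatio_nonneg μ φ)) ?_
  obtain ⟨n₀, hn₀⟩ := eventually_atTop.1 (hK.tendsto_unitMonomial.eventually_lt_const hε)
  filter_upwards [eventually_ge_atTop (n₀ + 1)] with j hj
  obtain ⟨n, rfl⟩ := Nat.exists_eq_add_of_le' (Nat.one_le_of_lt hj)
  have h1 : ‖K (unitMonomial n)‖ < ε := hn₀ n (by omega)
  have h2 : powerRatio μ φ (n + 1) ≤ ‖T (unitMonomial n)‖ := powerRatio_succ_le_norm hmaps n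
  have h3 := (T - K).le_opNorm (unitMonomial n)
  rw [norm_unitMonomial, mul_one] at h3
  have h4 : T (unitMonomial n) = (T - K) (unitMonomial n) + K (unitMonomial n) := by simp
  rw [h4] at h2
  linarith [norm_add_le ((T - K) (unitMonomial n)) (K (unitMonomial n))]

/-! ### Linear functionals and Taylor coefficients of the derivative -/

/-- The derivative at a point, as a linear functional on the Bloch space. -/
noncomputable def BlochSpace.derivAt {ν : DiscWeight} (z : 𝔻) : BlochSpace ν →ₗ[ℂ] ℂ where
  toFun f := discDeriv f.toFun z
  map_add' f g := discDeriv_add f.isBloch.1 g.isBloch.1 z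
  map_smul' c f := discDeriv_smul c f.toFun z

/-- The value at a point, as a linear functional on the Bloch space. -/
def BlochSpace.evalAt {ν : DiscWeight} (z : 𝔻) : BlochSpace ν →ₗ[ℂ] ℂ where
  toFun f := f.toFun z
  map_add' _ _ := rfl
  map_smul' _ _ := rfl

theorem isBloch_one (ν : DiscWeight) : IsBloch ν fun _ => 1 := by
  obtain ⟨h1, h2⟩ := discHolomorphic_of_hasDerivAt (f := fun _ => 1) (F := fun _ => 1)
    (f' := fun _ => 0) (fun _ => rfl) (fun z => hasDerivAt_const _ _)
  refine ⟨h1, 0, ?_⟩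
  rintro _ ⟨z, rfl⟩
  simp [h2]

theorem BlochSpace.derivAt_one {ν : DiscWeight} (z : 𝔻) :
    BlochSpace.derivAt z (BlochSpace.mk _ (isBloch_one ν)) = 0 :=
  (discHolomorphic_of_hasDerivAt (f := fun _ => 1) (F := fun _ => 1)
    (f' := fun _ => 0) (fun _ => rfl) (fun _ => hasDerivAt_const _ _)).2 z

theorem BlochSpace.norm_derivAt_le {ν : DiscWeight} (f : BlochSpace ν) (z : 𝔻) :
    ‖discDeriv f.toFun z‖ ≤ ‖f‖ / ν z := by
  rw [le_div_iff₀ (ν.pos' z), mul_comm, BlochSpace.norm_def]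
  linarith [f.le_seminorm z, norm_nonneg (f.toFun 0)]

theorem DiscHolomorphic.differentiableOn_deriv {f : 𝔻 → ℂ} (hf : DiscHolomorphic f) :
    DifferentiableOn ℂ (deriv (discExt f)) (Metric.ball 0 1) :=
  DifferentiableOn.deriv hf Metric.isOpen_ball

theorem DiscHolomorphic.contDiffAt_zero {f : 𝔻 → ℂ} (hf : DiscHolomorphic f) (n : ℕ) :
    ContDiffAt ℂ n (discExt f) 0 :=
  (DifferentiableOn.analyticAt hf (Metric.ball_mem_nhds 0 one_pos)).contDiffAt

/-- The `n`-th Taylor coefficient of the derivative, as a linear functional. -/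
noncomputable def derivCoeffLin (n : ℕ) : BlochSpace logWeight →ₗ[ℂ] ℂ where
  toFun f := iteratedDeriv (n + 1) (discExt f.toFun) 0 / n.factorial
  map_add' f g := by
    have h : discExt (f + g).toFun = discExt f.toFun + discExt g.toFun := discExt_add _ _
    rw [h, iteratedDeriv_add (f.isBloch.1.contDiffAt_zero _) (g.isBloch.1.contDiffAt_zero _),
      add_div]
  map_smul' c f := by
    have h : discExt (c • f).toFun = c • discExt f.toFun := discExt_smul _ _
    rw [h, iteratedDeriv_const_smul (f.isBloch.1.contDiffAt_zero _), smul_eq_mul, smul_eq_mul,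
      RingHom.id_apply, mul_div_assoc]

/-- Cauchy's estimate for `f'` on the circle of radius `s`, where the weight is constant. The radius
stays free because later uses need it beyond a prescribed disc. -/
theorem norm_derivCoeffLin_le (n : ℕ) (f : BlochSpace logWeight) {s : ℝ} (h0 : 0 < s)
    (h1 : s < 1) : ‖derivCoeffLin n f‖ ≤ ‖f‖ / logProfile (1 - s) / s ^ n := by
  have h := Complex.norm_iteratedDeriv_le_of_forall_mem_sphere_norm_le n h0 (c := 0)
    (C := ‖f‖ / logProfile (1 - s)) (f := deriv (discExt f.toFun))
    (f.isBloch.1.differentiableOn_deriv.diffContOnCl_ball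
      (Metric.closedBall_subset_ball h1)) (fun z hz => ?_)
  · change ‖iteratedDeriv (n + 1) (discExt f.toFun) 0 / n.factorial‖ ≤ _
    rw [norm_div, iteratedDeriv_succ', Complex.norm_natCast, div_le_iff₀ (by positivity)]
    calc _ ≤ _ := h
      _ = _ := by ring
  · have hz' : ‖z‖ = s := mem_sphere_zero_iff_norm.1 hz
    subst hz'
    exact f.norm_derivAt_le (Complex.UnitDisc.mk z h1)

/-- The `n`-th Taylor coefficient of the derivative, as a continuous linear functional. -/
noncomputable def derivCoeff (n : ℕ) : BlochSpace logWeight →L[ℂ] ℂ :=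
  (derivCoeffLin n).mkContinuous (1 / logProfile (1 - 1 / 2) / (1 / 2) ^ n) fun f =>
    (norm_derivCoeffLin_le n f (by norm_num) (by norm_num : (1 / 2 : ℝ) < 1)).trans_eq (by ring)

theorem norm_derivCoeff_le (n : ℕ) (f : BlochSpace logWeight) {s : ℝ} (h0 : 0 < s)
    (h1 : s < 1) : ‖derivCoeff n f‖ ≤ ‖f‖ / logProfile (1 - s) / s ^ n :=
  norm_derivCoeffLin_le n f h0 h1

theorem hasSum_derivCoeff (f : BlochSpace logWeight) (w : 𝔻) :
    HasSum (fun n => derivCoeff n f * (w : ℂ) ^ n) (discDeriv f.toFun w) := by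
  have h := Complex.hasSum_taylorSeries_on_ball f.isBloch.1.differentiableOn_deriv
    (mem_ball_zero_iff.2 w.norm_lt_one)
  refine (congrArg (HasSum · _) (funext fun n => ?_)).mpr h
  change iteratedDeriv (n + 1) (discExt f.toFun) 0 / n.factorial * _ = _
  rw [iteratedDeriv_succ', sub_zero, smul_eq_mul, smul_eq_mul]
  ring

theorem hasSum_derivCoeff_dilate (f : BlochSpace logWeight) (w : 𝔻) {r : ℝ}
    (hrw : ‖(r * w : ℂ)‖ < 1) :
    HasSum (fun n => derivCoeff n f * (r : ℂ) ^ (n + 1) * (w : ℂ) ^ n)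
      (r * discDeriv f.toFun (Complex.UnitDisc.mk _ hrw)) := by
  refine (congrArg (HasSum · _) (funext fun n => ?_)).mpr
    ((hasSum_derivCoeff f (Complex.UnitDisc.mk _ hrw)).mul_left (r : ℂ))
  rw [Complex.UnitDisc.coe_mk]
  ring

theorem logProfile_one_sub_pos {s : ℝ} (h0 : 0 ≤ s) (h1 : s < 1) : 0 < logProfile (1 - s) :=
  mul_pos (by linarith) (zero_lt_one.trans_le (one_le_log_three_div (by linarith) (by linarith)))

/-! ### Finite rank approximation of the identity -/

/-- Dilations approximate the derivative uniformly on smaller discs and on bounded sets of `f`. -/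
theorem exists_dilate_close {s₀ ε : ℝ} (h0 : 0 ≤ s₀) (h1 : s₀ < 1) (hε : 0 < ε) :
    ∃ r : ℝ, 0 < r ∧ r < 1 ∧ ∀ (f : BlochSpace logWeight) (w : 𝔻) (hrw : ‖(r * w : ℂ)‖ < 1),
      ‖(w : ℂ)‖ ≤ s₀ →
      ‖discDeriv f.toFun w - r * discDeriv f.toFun (Complex.UnitDisc.mk _ hrw)‖ ≤ ε * ‖f‖ := by
  obtain ⟨s, hss, hs1⟩ := exists_between h1
  have hs0 : 0 < s := h0.trans_lt hss
  set x := s₀ / s with hx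
  have hx0 : 0 ≤ x := by positivity
  have hx1 : x < 1 := by rw [hx, div_lt_one hs0]; linarith
  set v := logProfile (1 - s)
  have hv : 0 < v := logProfile_one_sub_pos hs0.le hs1
  have hsum : Summable fun n : ℕ => ((n : ℝ) + 1) * x ^ n := by
    have hn : ‖x‖ < 1 := by rwa [Real.norm_of_nonneg hx0]
    simpa [add_mul] using (hasSum_coe_mul_geometric_of_norm_lt_one hn).summable.add
      (summable_geometric_of_lt_one hx0 hx1)
  obtain ⟨C, hC⟩ := hsum
  have hC0 : 0 ≤ C := hC.nonneg fun n => by positivity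
  -- By Bernoulli, dilating by `1 - δ` changes the `n`-th coefficient by a relative amount of at
  -- most `(n + 1) δ`. With Cauchy's estimate at radius `s > s₀` the total error is at most `δ C ‖f‖
  -- / v`, with `C = ∑ (n + 1) (s₀ / s) ^ n`.
  set δ := min (1 / 2) (ε * v / (C + 1)) with hδ
  have hδ0 : 0 < δ := lt_min (by norm_num) (by positivity)
  have hδ1 : δ ≤ 1 / 2 := min_le_left _ _
  have hδC : δ * C ≤ ε * v := by
    have : δ * (C + 1) ≤ ε * v := (le_div_iff₀ (by positivity)).1 (min_le_right _ _)
    linarith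
  refine ⟨1 - δ, by linarith, by linarith, fun f w hrw hw => ?_⟩
  have key := ((hasSum_derivCoeff f w).sub (hasSum_derivCoeff_dilate f w hrw)).norm_le_of_bounded
    (hC.mul_left (‖f‖ / v * δ)) (fun n => ?_)
  · refine key.trans ?_
    calc ‖f‖ / v * δ * C = ‖f‖ / v * (δ * C) := by ring
      _ ≤ ‖f‖ / v * (ε * v) := by gcongr
      _ = ε * ‖f‖ := by field_simp
  · have e1 : derivCoeff n f * (w : ℂ) ^ n - derivCoeff n f * ((1 - δ : ℝ) : ℂ) ^ (n + 1) * (w : ℂ) ^ n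
        = derivCoeff n f * ((1 - (1 - δ) ^ (n + 1) : ℝ) : ℂ) * (w : ℂ) ^ n := by
      push_cast
      ring
    have h2 : 1 - (1 - δ) ^ (n + 1) ≤ (n + 1) * δ := by
      have := one_add_mul_le_pow (a := -δ) (by linarith) (n + 1)
      push_cast at this
      rw [← sub_eq_add_neg] at this
      linarith
    have h3 : 0 ≤ 1 - (1 - δ) ^ (n + 1) :=
      sub_nonneg.2 (pow_le_one₀ (by linarith) (by linarith))
    rw [e1, norm_mul, norm_mul, norm_pow, Complex.norm_real, Real.norm_of_nonneg h3]
    calc _ ≤ ‖f‖ / v / s ^ n * ((n + 1) * δ) * s₀ ^ n := by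
          gcongr
          exact norm_derivCoeff_le n f hs0 hs1
      _ = _ := by
          rw [hx, div_pow]
          ring

/-- The Taylor polynomials of a dilation converge uniformly on the disc and on bounded sets. -/
theorem exists_taylor_close {r ε : ℝ} (h0 : 0 < r) (h1 : r < 1) (hε : 0 < ε) :
    ∃ N : ℕ, ∀ (f : BlochSpace logWeight) (w : 𝔻) (hrw : ‖(r * w : ℂ)‖ < 1),
      ‖r * discDeriv f.toFun (Complex.UnitDisc.mk _ hrw) -
        ∑ n ∈ Finset.range N, derivCoeff n f * (r : ℂ) ^ (n + 1) * (w : ℂ) ^ n‖ ≤ ε * ‖f‖ := by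
  -- Cauchy's estimate at a radius `s > r` makes the Taylor tail of the dilation geometric with
  -- ratio `r / s`, even at the boundary of the disc.
  obtain ⟨s, hss, hs1⟩ := exists_between h1
  have hs0 : 0 < s := h0.trans hss
  set q := r / s with hq
  have hq0 : 0 ≤ q := by positivity
  have hq1 : q < 1 := by rw [hq, div_lt_one hs0]; linarith
  set v := logProfile (1 - s)
  have hv : 0 < v := logProfile_one_sub_pos hs0.le hs1
  obtain ⟨N, hN⟩ := exists_pow_lt_of_lt_one (show 0 < ε * v * (1 - q) by
    have : 0 < 1 - q := by linarith
    positivity) hq1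
  refine ⟨N, fun f w hrw => ?_⟩
  have key := ((hasSum_nat_add_iff' N).2 (hasSum_derivCoeff_dilate f w hrw)).norm_le_of_bounded
    ((hasSum_geometric_of_lt_one hq0 hq1).mul_left (‖f‖ / v * q ^ N)) (fun n => ?_)
  · refine key.trans ?_
    calc ‖f‖ / v * q ^ N * (1 - q)⁻¹ ≤ ‖f‖ / v * (ε * v * (1 - q)) * (1 - q)⁻¹ := by
          have : 0 ≤ (1 - q)⁻¹ := inv_nonneg.2 (by linarith)
          gcongr
      _ = ε * ‖f‖ := by
          have : 1 - q ≠ 0 := by linarith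
          field_simp
  · rw [norm_mul, norm_mul, norm_pow, norm_pow, Complex.norm_real, Real.norm_of_nonneg h0.le]
    calc _ ≤ ‖f‖ / v / s ^ (n + N) * r ^ (n + N) * 1 := by
          have hw := w.norm_lt_one.le
          refine mul_le_mul (mul_le_mul (norm_derivCoeff_le _ f hs0 hs1) ?_ (by positivity)
            (by positivity)) (pow_le_one₀ (norm_nonneg _) hw) (by positivity) (by positivity)
          exact pow_le_pow_of_le_one h0.le h1.le (Nat.le_succ _)
      _ = _ := by
          rw [hq, mul_assoc (‖f‖ / v), ← pow_add, add_comm N n, div_pow]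
          ring

/-- The finite rank operator sending `f` to the `N`-th Taylor polynomial of its dilation
`f (r ·)`, corrected by a constant so as to interpolate at a point `a` the functional `ev`. -/
noncomputable def taylorDilate (ev : BlochSpace logWeight →L[ℂ] ℂ) (a : 𝔻) (r : ℝ) (N : ℕ) :
    BlochSpace logWeight →L[ℂ] BlochSpace logWeight :=
  ev.smulRight (BlochSpace.mk _ (isBloch_one _)) + ∑ n ∈ Finset.range N,
    (derivCoeff n).smulRight (((r : ℂ) ^ (n + 1) / (n + 1)) •
      (BlochSpace.mk _ (isBloch_pow n) - (a : ℂ) ^ (n + 1) • BlochSpace.mk _ (isBloch_one _)))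

theorem isCompactOperator_smulRight {X Y : Type*} [NormedAddCommGroup X] [NormedSpace ℂ X]
    [NormedAddCommGroup Y] [NormedSpace ℂ Y] (l : X →L[ℂ] ℂ) (y : Y) :
    IsCompactOperator (l.smulRight y) :=
  (isCompactOperator_of_locallyCompactSpace_dom l).clm_comp (ContinuousLinearMap.toSpanSingleton ℂ y)

theorem isCompactOperator_sum {X Y ι : Type*} [NormedAddCommGroup X] [NormedSpace ℂ X]
    [NormedAddCommGroup Y] [NormedSpace ℂ Y] (s : Finset ι) (T : ι → X →L[ℂ] Y)
    (h : ∀ i ∈ s, IsCompactOperator (T i)) : IsCompactOperator (∑ i ∈ s, T i : X →L[ℂ] Y) :=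
  Finset.sum_induction T (fun S => IsCompactOperator S) (fun _ _ h1 h2 => h1.add h2)
    isCompactOperator_zero h

theorem isCompactOperator_taylorDilate (ev : BlochSpace logWeight →L[ℂ] ℂ) (a : 𝔻) (r : ℝ)
    (N : ℕ) : IsCompactOperator (taylorDilate ev a r N) :=
  (isCompactOperator_smulRight _ _).add
    (isCompactOperator_sum _ _ fun _ _ => isCompactOperator_smulRight _ _)

theorem taylorDilate_apply (ev : BlochSpace logWeight →L[ℂ] ℂ) (a : 𝔻) (r : ℝ) (N : ℕ)
    (f : BlochSpace logWeight) : taylorDilate ev a r N f =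
      ev f • BlochSpace.mk _ (isBloch_one _) + ∑ n ∈ Finset.range N,
        derivCoeff n f • (((r : ℂ) ^ (n + 1) / (n + 1)) • (BlochSpace.mk _ (isBloch_pow n) -
          (a : ℂ) ^ (n + 1) • BlochSpace.mk _ (isBloch_one _))) := by
  simp [taylorDilate]

theorem taylorDilate_eval (ev : BlochSpace logWeight →L[ℂ] ℂ) (a : 𝔻) (r : ℝ) (N : ℕ)
    (f : BlochSpace logWeight) : (taylorDilate ev a r N f).toFun a = ev f := by
  change BlochSpace.evalAt a (taylorDilate ev a r N f) = _
  have h1 : BlochSpace.evalAt a (BlochSpace.mk _ (isBloch_one logWeight)) = 1 := rfl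
  have h2 : ∀ n, BlochSpace.evalAt a (BlochSpace.mk _ (isBloch_pow n)) = (a : ℂ) ^ (n + 1) :=
    fun n => rfl
  simp only [taylorDilate_apply, map_add, map_sum, map_smul, map_sub, h1, h2, smul_eq_mul]
  simp

theorem discDeriv_taylorDilate (ev : BlochSpace logWeight →L[ℂ] ℂ) (a : 𝔻) (r : ℝ) (N : ℕ)
    (f : BlochSpace logWeight) (w : 𝔻) : discDeriv (taylorDilate ev a r N f).toFun w =
      ∑ n ∈ Finset.range N, derivCoeff n f * (r : ℂ) ^ (n + 1) * (w : ℂ) ^ n := by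
  change BlochSpace.derivAt w (taylorDilate ev a r N f) = _
  have h2 : ∀ n, BlochSpace.derivAt w (BlochSpace.mk _ (isBloch_pow n)) =
      ((n + 1 : ℕ) : ℂ) * (w : ℂ) ^ n := fun n => (discHolomorphic_pow (n + 1)).2 w
  simp only [taylorDilate_apply, map_add, map_sum, map_smul, map_sub, h2, smul_eq_mul,
    BlochSpace.derivAt_one, mul_zero, sub_zero, zero_add]
  refine Finset.sum_congr rfl fun n _ => ?_
  have : ((n : ℂ) + 1) ≠ 0 := by exact_mod_cast n.succ_ne_zero
  push_cast
  field_simp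

/-- Split the error at the derivative of the dilation. The Taylor remainder is uniformly small; the
other part is small on the smaller disc, and elsewhere each of its two terms costs `‖f‖ / logWeight
w`, since the weight is larger at `r w` than at `w`. -/
theorem exists_taylorDilate_close {s₀ ε : ℝ} (h0 : 0 ≤ s₀) (h1 : s₀ < 1) (hε : 0 < ε)
    (ev : BlochSpace logWeight →L[ℂ] ℂ) (a : 𝔻) :
    ∃ (r : ℝ) (N : ℕ), ∀ (f : BlochSpace logWeight) (w : 𝔻),
      (‖(w : ℂ)‖ ≤ s₀ → ‖discDeriv (f - taylorDilate ev a r N f).toFun w‖ ≤ ε * ‖f‖) ∧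
      ‖discDeriv (f - taylorDilate ev a r N f).toFun w‖ ≤ (2 / logWeight w + ε) * ‖f‖ := by
  obtain ⟨r, hr0, hr1, hr⟩ := exists_dilate_close h0 h1 (half_pos hε)
  obtain ⟨N, hN⟩ := exists_taylor_close hr0 hr1 (half_pos hε)
  refine ⟨r, N, fun f w => ?_⟩
  have hnorm : ‖(r * w : ℂ)‖ = r * ‖(w : ℂ)‖ := by
    rw [norm_mul, Complex.norm_real, Real.norm_of_nonneg hr0.le]
  have hle : r * ‖(w : ℂ)‖ ≤ ‖(w : ℂ)‖ := mul_le_of_le_one_left (norm_nonneg _) hr1.le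
  have hrw : ‖(r * w : ℂ)‖ < 1 := by
    rw [hnorm]
    exact hle.trans_lt w.norm_lt_one
  have hd : discDeriv (f - taylorDilate ev a r N f).toFun w =
      (discDeriv f.toFun w - r * discDeriv f.toFun (Complex.UnitDisc.mk _ hrw)) +
        (r * discDeriv f.toFun (Complex.UnitDisc.mk _ hrw) -
        ∑ n ∈ Finset.range N, derivCoeff n f * (r : ℂ) ^ (n + 1) * (w : ℂ) ^ n) := by
    rw [← discDeriv_taylorDilate ev a r N f w, sub_add_sub_cancel]
    exact map_sub (BlochSpace.derivAt w) f (taylorDilate ev a r N f)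
  have h2 := hN f w hrw
  rw [hd]
  refine ⟨fun hw => (norm_add_le _ _).trans ?_, (norm_add_le _ _).trans ?_⟩
  · linarith [hr f w hrw hw]
  · have h3 := f.norm_derivAt_le w
    have h4 : ‖r * discDeriv f.toFun (Complex.UnitDisc.mk _ hrw)‖ ≤ ‖f‖ / logWeight w := by
      rw [norm_mul, Complex.norm_real, Real.norm_of_nonneg hr0.le]
      refine (mul_le_of_le_one_left (norm_nonneg _) hr1.le).trans ((f.norm_derivAt_le _).trans ?_)
      refine div_le_div_of_nonneg_left (norm_nonneg f) (logWeight.pos' w) ?_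
      rw [logWeight_apply, logWeight_apply, Complex.UnitDisc.coe_mk, hnorm]
      exact logProfile_mono (sub_pos.2 w.norm_lt_one) (by linarith)
        (by linarith [mul_nonneg hr0.le (norm_nonneg (w : ℂ))])
    have h5 := norm_sub_le (discDeriv f.toFun w)
      (r * discDeriv f.toFun (Complex.UnitDisc.mk _ hrw))
    have h6 : (2 / logWeight w + ε) * ‖f‖ =
      ‖f‖ / logWeight w + ‖f‖ / logWeight w + ε / 2 * ‖f‖ + ε / 2 * ‖f‖ := by ring
    linarith [mul_nonneg hε.le (norm_nonneg f)]

/-! ### The upper bound for the essential norm -/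

/-- Near the boundary the power ratios control the symbol of the composition operator. -/
theorem exists_symbol_le {μ : DiscWeight} {φ : 𝔻 → 𝔻}
    (hφ : DiscHolomorphic fun z => (φ z : ℂ))
    (hmaps : ∀ f : 𝔻 → ℂ, IsBloch logWeight f → IsBloch μ (f ∘ φ)) {E : ℝ} (hE0 : 0 ≤ E)
    (hE : ∀ᶠ j in atTop, powerRatio μ φ j ≤ E) :
    ∃ s₀ : ℝ, 0 ≤ s₀ ∧ s₀ < 1 ∧ ∀ z, s₀ < ‖(φ z : ℂ)‖ →
      μ z * ‖discDeriv (fun z => (φ z : ℂ)) z‖ ≤ 2 * Real.exp 1 * E * logWeight (φ z) := by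
  obtain ⟨J, hJ⟩ := eventually_atTop.1 hE
  have hJ1 : (0 : ℝ) < J + 1 := by positivity
  refine ⟨1 - 1 / (J + 1), ?_, ?_, fun z hz => ?_⟩
  · rw [sub_nonneg, div_le_one hJ1]
    linarith [Nat.cast_nonneg (α := ℝ) J]
  · linarith [one_div_pos.2 hJ1]
  set ρ := ‖(φ z : ℂ)‖ with hρ
  set t := 1 - ρ with ht
  have ht0 : 0 < t := sub_pos.2 (φ z).norm_lt_one
  have hρ0 : 0 ≤ ρ := norm_nonneg _
  have htJ : (J + 1 : ℕ) ≤ 1 / t := by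
    push_cast
    rw [le_one_div hJ1 ht0]
    linarith
  -- The tested degree is `n + 1 = ⌊1 / t⌋`, so that `(n + 1) t` lies in `[1 / 2, 1]` and `ρ ^ n ≥ 1
  -- / e`: the monomial is near its peak at `φ z`. The choice of `s₀` puts this degree in the range
  -- where the ratios are at most `E`.
  have hfl : J + 1 ≤ ⌊1 / t⌋₊ := Nat.le_floor htJ
  obtain ⟨n, hn⟩ := Nat.exists_eq_add_of_le' (Nat.one_le_of_lt hfl)
  have hnt : ((n : ℝ) + 1) * t ≤ 1 := by
    have := Nat.floor_le (one_div_pos.2 ht0).le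
    rw [hn, le_div_iff₀ ht0] at this
    exact_mod_cast this
  have hnt' : 1 ≤ ((n : ℝ) + 2) * t := by
    have := (Nat.lt_floor_add_one (1 / t)).le
    rw [hn, div_le_iff₀ ht0] at this
    push_cast at this
    linarith
  have hn0 : (0 : ℝ) ≤ n := Nat.cast_nonneg n
  have hhalf : 1 / 2 ≤ ((n : ℝ) + 1) * t := by nlinarith
  have ht1 : t ≤ 1 := by linarith
  set P : ℝ := (n + 1) * ρ ^ n with hP
  have hcomp := (discHolomorphic_comp (discHolomorphic_pow (n + 1)).1 hφ).2 z
  have h1 : μ z * ‖discDeriv (fun z => (φ z : ℂ)) z‖ * P ≤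
      blochSeminorm μ (fun z => (φ z : ℂ) ^ (n + 1)) := by
    refine le_trans (le_of_eq ?_) (le_ciSup (hmaps _ (isBloch_pow n)).2 z)
    simp only [hcomp]
    rw [(discHolomorphic_pow (n + 1)).2, norm_mul, norm_mul, norm_pow, Complex.norm_natCast,
      Nat.add_sub_cancel, hP]
    push_cast
    ring
  have h2 : blochSeminorm μ (fun z => (φ z : ℂ) ^ (n + 1)) ≤ E * Real.log (3 * (n + 1)) := by
    have h := hJ (n + 1) (by omega)
    rw [powerRatio, div_le_iff₀ (blochSeminorm_pow_pos n)] at h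
    exact h.trans (mul_le_mul_of_nonneg_left (blochSeminorm_pow_le n) hE0)
  have hlog : Real.log (3 * (n + 1)) ≤ Real.log (3 / t) := by
    refine Real.log_le_log (by positivity) ?_
    rw [le_div_iff₀ ht0]
    linarith
  have hlog0 : 0 ≤ Real.log (3 / t) := zero_le_one.trans (one_le_log_three_div ht0 ht1)
  have hpow : Real.exp (-1) ≤ ρ ^ n := by
    rcases Nat.eq_zero_or_pos n with rfl | hpos
    · simp
    · have h3 : (1 : ℝ) ≤ n := by exact_mod_cast hpos
      have := exp_neg_one_le_one_sub_pow (t := t) (by nlinarith) hnt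
      rwa [ht, sub_sub_cancel] at this
  have hP0 : 0 < P := mul_pos (by positivity) ((Real.exp_pos _).trans_le hpow)
  have h3 : Real.log (3 / t) ≤ 2 * Real.exp 1 * (P * logProfile t) := by
    have h4 : 1 ≤ 2 * Real.exp 1 * (P * t) := by
      calc (1 : ℝ) = 2 * Real.exp 1 * (1 / 2 * Real.exp (-1)) := by
            rw [Real.exp_neg]
            field_simp
        _ ≤ 2 * Real.exp 1 * (((n : ℝ) + 1) * t * ρ ^ n) := by gcongr
        _ = _ := by rw [hP]; ring
    calc Real.log (3 / t) ≤ 2 * Real.exp 1 * (P * t) * Real.log (3 / t) :=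
          le_mul_of_one_le_left hlog0 h4
      _ = _ := by rw [logProfile]; ring
  refine le_of_mul_le_mul_right ?_ hP0
  calc _ ≤ E * Real.log (3 * (n + 1)) := h1.trans h2
    _ ≤ E * (2 * Real.exp 1 * (P * logProfile t)) :=
        mul_le_mul_of_nonneg_left (hlog.trans h3) hE0
    _ = _ := by rw [logWeight_apply]; ring

theorem essentialNorm_le_of_isCompactOperator {X Y : Type*} [NormedAddCommGroup X]
    [NormedSpace ℂ X] [NormedAddCommGroup Y] [NormedSpace ℂ Y] (T K : X →L[ℂ] Y)
    (hK : IsCompactOperator K) : essentialNorm T ≤ ‖T - K‖ := by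
  refine csInf_le ⟨0, ?_⟩ ⟨K, hK, rfl⟩
  rintro _ ⟨K, -, rfl⟩
  exact norm_nonneg _

theorem essentialNorm_le_of_eventually_powerRatio_le {μ : DiscWeight} {φ : 𝔻 → 𝔻}
    (hφ : DiscHolomorphic fun z => (φ z : ℂ))
    (hmaps : ∀ f : 𝔻 → ℂ, IsBloch logWeight f → IsBloch μ (f ∘ φ))
    (hbdd : ∃ C : ℝ, ∀ f : BlochSpace logWeight, ‖compOperator φ hmaps f‖ ≤ C * ‖f‖)
    {E : ℝ} (hE0 : 0 ≤ E) (hE : ∀ᶠ j in atTop, powerRatio μ φ j ≤ E) :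
    essentialNorm ((compOperator φ hmaps).mkContinuousOfExistsBound hbdd) ≤
      4 * Real.exp 1 * E := by
  set T := (compOperator φ hmaps).mkContinuousOfExistsBound hbdd
  obtain ⟨s₀, hs0, hs1, hs⟩ := exists_symbol_le hφ hmaps hE0 hE
  -- The symbol itself is in the target space, as the image of the identity function.
  obtain ⟨M, hM⟩ : ∃ M, ∀ z, μ z * ‖discDeriv (fun z => (φ z : ℂ)) z‖ ≤ M := by
    obtain ⟨M, hM⟩ := (hmaps _ (isBloch_pow 0)).2
    refine ⟨M, fun z => le_trans (le_of_eq ?_) (hM ⟨z, rfl⟩)⟩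
    simp [Function.comp_def]
  have hM0 : 0 ≤ M := (mul_nonneg (μ.pos' 0).le (norm_nonneg _)).trans (hM 0)
  -- Evaluation at `φ 0`, written as evaluation at the origin after `T`, so that its continuity
  -- comes from that of `T`. Interpolating it makes `T (f - K f)` vanish at the origin, leaving only
  -- the seminorm to estimate.
  let ev : BlochSpace logWeight →L[ℂ] ℂ :=
    ((BlochSpace.evalAt (ν := μ) 0).mkContinuous 1 fun f => by
      rw [one_mul, BlochSpace.norm_def]
      exact le_add_of_nonneg_right (BlochSpace.seminorm_nonneg _)).comp T
  have hev : ∀ f, ev f = f.toFun (φ 0) := fun f => rfl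
  refine le_of_forall_pos_le_add fun η hη => ?_
  obtain ⟨r, N, hclose⟩ := exists_taylorDilate_close hs0 hs1
    (show 0 < η / (M + 1) by positivity) ev (φ 0)
  set K := taylorDilate ev (φ 0) r N
  refine (essentialNorm_le_of_isCompactOperator T (T.comp K)
    ((isCompactOperator_taylorDilate ev (φ 0) r N).clm_comp T)).trans ?_
  refine ContinuousLinearMap.opNorm_le_bound _ (by positivity) fun f => ?_
  have hTK : (T - T.comp K) f = compOperator φ hmaps (f - K f) := (map_sub T f (K f)).symm
  have hf := norm_nonneg f
  have hval : (compOperator φ hmaps (f - K f)).toFun 0 = 0 := by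
    change f.toFun (φ 0) - (K f).toFun (φ 0) = 0
    rw [taylorDilate_eval, hev, sub_self]
  rw [hTK, BlochSpace.norm_def, hval, norm_zero, zero_add]
  refine ciSup_le fun z => ?_
  have hcomp : discDeriv (compOperator φ hmaps (f - K f)).toFun z =
      discDeriv (f - K f).toFun (φ z) * discDeriv (fun z => (φ z : ℂ)) z :=
    (discHolomorphic_comp (f - K f).isBloch.1 hφ).2 z
  set m := μ z * ‖discDeriv (fun z => (φ z : ℂ)) z‖ with hm
  have hm0 : 0 ≤ m := mul_nonneg (μ.pos' z).le (norm_nonneg _)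
  have hmη : m * (η / (M + 1)) ≤ η := by
    rw [mul_div_assoc', div_le_iff₀ (by positivity)]
    nlinarith [hM z]
  have e1 : μ z * ‖discDeriv (compOperator φ hmaps (f - K f)).toFun z‖ =
      m * ‖discDeriv (f - K f).toFun (φ z)‖ := by
    rw [hcomp, norm_mul, hm]
    ring
  rw [e1]
  obtain ⟨hc1, hc2⟩ := hclose f (φ z)
  have hEe : 0 ≤ 4 * Real.exp 1 * E := by positivity
  rcases le_or_gt ‖(φ z : ℂ)‖ s₀ with hle | hgt
  · calc _ ≤ m * (η / (M + 1) * ‖f‖) := mul_le_mul_of_nonneg_left (hc1 hle) hm0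
      _ = m * (η / (M + 1)) * ‖f‖ := by ring
      _ ≤ _ := mul_le_mul_of_nonneg_right (by linarith) hf
  · have hv := logWeight.pos' (φ z)
    have h3 : m * (2 / logWeight (φ z)) ≤ 4 * Real.exp 1 * E := by
      rw [mul_div_assoc', div_le_iff₀ hv]
      linarith [hs z hgt]
    calc _ ≤ m * ((2 / logWeight (φ z) + η / (M + 1)) * ‖f‖) :=
          mul_le_mul_of_nonneg_left hc2 hm0
      _ = (m * (2 / logWeight (φ z)) + m * (η / (M + 1))) * ‖f‖ := by ring
      _ ≤ _ := mul_le_mul_of_nonneg_right (by linarith) hf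

/-! ### Comparison of constants and conclusion -/

/-- Since `log 3 ≤ 6 / 5`, one has `logConst ≤ 1 / 6`, and `exp (logConst - 1) ≥ 1 / 3`; so the
right side is at least `2 + 2 / logConst ≥ 14`, while `4 e < 12`. -/
theorem four_mul_exp_one_le : 4 * Real.exp 1 ≤
    (2 * logConst + 6 * Real.exp (logConst - 1)) / logConst := by
  have h1 := one_lt_log_three
  have h2 : Real.log 3 ≤ 6 / 5 := Real.log_three_lt_d9.le.trans (by norm_num)
  have hL0 : 0 < logConst := by
    rw [logConst, sub_pos, div_lt_one (by linarith)]
    exact h1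
  have hL1 : logConst ≤ 1 / 6 := by
    have : 5 / 6 ≤ 1 / Real.log 3 := by
      rw [le_div_iff₀ (by linarith)]
      linarith
    rw [logConst]
    linarith
  have he := Real.exp_one_lt_three
  have h3 : 1 / 3 ≤ Real.exp (logConst - 1) := by
    refine le_trans ?_ (Real.exp_le_exp.2 (show -1 ≤ logConst - 1 by linarith))
    rw [Real.exp_neg, one_div]
    exact inv_anti₀ (Real.exp_pos 1) he.le
  rw [le_div_iff₀ hL0]
  nlinarith

theorem theorem5p1 (μ : DiscWeight) (φ : 𝔻 → 𝔻)
    (hφ : DiscHolomorphic fun z => (φ z : ℂ))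
    (hmaps : ∀ f : 𝔻 → ℂ, IsBloch logWeight f → IsBloch μ (f ∘ φ))
    (hbdd : ∃ C : ℝ, ∀ f : BlochSpace logWeight, ‖compOperator φ hmaps f‖ ≤ C * ‖f‖) :
    IsBoundedUnder (· ≤ ·) atTop (powerRatio μ φ) ∧
    limsup (powerRatio μ φ) atTop ≤
      essentialNorm ((compOperator φ hmaps).mkContinuousOfExistsBound hbdd) ∧
    essentialNorm ((compOperator φ hmaps).mkContinuousOfExistsBound hbdd) ≤
      (2 * logConst + 6 * Real.exp (logConst - 1)) / logConst *
        limsup (powerRatio μ φ) atTop := by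
  have hb := isBoundedUnder_powerRatio hmaps hbdd
  have h0 : 0 ≤ limsup (powerRatio μ φ) atTop :=
    le_limsup_of_frequently_le (Frequently.of_forall (powerRatio_nonneg μ φ)) hb
  refine ⟨hb, limsup_powerRatio_le_essentialNorm hmaps hbdd, ?_⟩
  refine le_trans ?_ (mul_le_mul_of_nonneg_right four_mul_exp_one_le h0)
  refine le_of_forall_pos_le_add fun ε hε => ?_
  have he := Real.exp_pos 1
  -- The ratios are eventually below any number strictly above their limsup; the excess `ε / (4 e)`
  -- becomes `ε` after multiplication by the constant.
  have h1 : limsup (powerRatio μ φ) atTop <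
      limsup (powerRatio μ φ) atTop + ε / (4 * Real.exp 1) :=
    lt_add_of_pos_right _ (by positivity)
  refine (essentialNorm_le_of_eventually_powerRatio_le hφ hmaps hbdd (h0.trans h1.le)
    ((eventually_lt_of_limsup_lt h1 hb).mono fun _ h => h.le)).trans (le_of_eq ?_)
  field_simp
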